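/- An operator algebra is a closed (not necessarily unital or selfadjoint) subalgebra of the bounded operators on a complex Hilbert space, with the norms this induces on all matrix spaces over it. A morphism is a completely contractive linear homomorphism. A morphism is a complete quotient map if at every matrix level it maps the open unit ball onto the open unit ball. A cai is a contractive two-sided approximate identity; an operator algebra with a cai is approximately unital; a morphism is proper if it takes some cai to a cai. For an approximately unital operator algebra $A$ let $\mathcal{M}(A)$ be its multiplier algebra (the algebra of double centralizers of $A$) and $\mathcal{Q}(A)=\mathcal{M}(A)/A$. A proper morphism $\mu:A_1\to A_2$ between such algebras has a canonical extension $\bar\mu:\mathcal{M}(A_1)\to\mathcal{M}(A_2)$, determined by $\bar\mu(x)\mu(a)=\mu(xa)$ and $\mu(a)\bar\mu(x)=\mu(ax)$ for $a\in A_1$, which induces $\tilde\mu:\mathcal{Q}(A_1)\to\mathcal{Q}(A_2)$. An extension of $C$ by $A$, with $A$ approximately unital, is an exact sequence $0\to A\overset{\alpha}{\to}B\overset{\beta}{\to}C\to0$ of operator algebras and morphisms with $\alpha$ completely isometric and $\beta$ a complete quotient map. Its Busby invariant is $\tau:C\to\mathcal{Q}(A)$, $\tau(\beta(b))=\sigma(b)+A$,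 where $\sigma:B\to\mathcal{M}(A)$ is given by $\sigma(b)a=\alpha^{-1}(b\,\alpha(a))$ and $a\,\sigma(b)=\alpha^{-1}(\alpha(a)\,b)$. **Theorem.** Let $0\to A_i\overset{\alpha_i}{\to}B_i\overset{\beta_i}{\to}C_i\to0$ $(i=1,2)$ be two extensions with Busby invariants $\tau_1,\tau_2$, and let $\mu:A_1\to A_2$ and $\nu:C_1\to C_2$ be morphisms, with $\mu$ proper. Then there exists a morphism $\rho:B_1\to B_2$ with $\rho\circ\alpha_1=\alpha_2\circ\mu$ and $\beta_2\circ\rho=\nu\circ\beta_1$ if and only if $\tilde\mu\circ\tau_1=\tau_2\circ\nu$. Moreover, there is at most one such $\rho$. -/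

import Mathlib

open Filter Topology
open scoped MultiplierAlgebra

universe u

noncomputable section

/-! ### Operator algebras and completely contractive homomorphisms -/

/-- The bounded operator on the Hilbert space `H ⊕ ⋯ ⊕ H` (`n` summands) given by an `n × n`
matrix of bounded operators on `H`, acting by `(T x) i = ∑ j, T i j (x j)`. -/
def matrixOperator {H : Type*} [NormedAddCommGroup H] [InnerProductSpace ℂ H] {n : ℕ}
    (T : Matrix (Fin n) (Fin n) (H →L[ℂ] H)) :
    PiLp 2 (fun _ : Fin n => H) →L[ℂ] PiLp 2 (fun _ : Fin n => H) :=
  ((PiLp.continuousLinearEquiv 2 ℂ (fun _ : Fin n => H)).symm :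
      (Fin n → H) →L[ℂ] PiLp 2 (fun _ : Fin n => H)) ∘L
    ContinuousLinearMap.pi fun i =>
      ∑ j, T i j ∘L PiLp.proj (𝕜 := ℂ) 2 (fun _ : Fin n => H) j

/-- An operator algebra: a (not necessarily unital) complete normed complex algebra together with
norms on all matrix spaces over it, which is, completely isometrically, an algebra of bounded
operators on a complex Hilbert space (its image is closed, because the algebra is complete). -/
class OperatorAlgebra (A : Type u) extends NonUnitalNormedRing A, CompleteSpace A,
    NormedSpace ℂ A, IsScalarTower ℂ A A, SMulCommClass ℂ A A where
  /-- The norm of an `n × n` matrix over `A`. -/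
  matrixNorm : ∀ {n : ℕ}, Matrix (Fin n) (Fin n) A → ℝ
  exists_representation : ∃ (H : Type u) (_ : NormedAddCommGroup H) (_ : InnerProductSpace ℂ H)
    (_ : CompleteSpace H) (π : A →ₙₐ[ℂ] (H →L[ℂ] H)),
    (∀ a, ‖π a‖ = ‖a‖) ∧
    ∀ (n : ℕ) (M : Matrix (Fin n) (Fin n) A), matrixNorm M = ‖matrixOperator (M.map π)‖

open OperatorAlgebra (matrixNorm)

/-- A morphism of operator algebras: a completely contractive (linear) homomorphism. -/
structure OAHom (A B : Type*) [OperatorAlgebra A] [OperatorAlgebra B] extends A →ₙₐ[ℂ] B where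
  completely_contractive : ∀ (n : ℕ) (M : Matrix (Fin n) (Fin n) A),
    matrixNorm (M.map toFun) ≤ matrixNorm M

instance {A B : Type*} [OperatorAlgebra A] [OperatorAlgebra B] : FunLike (OAHom A B) A B where
  coe f := f.toFun
  coe_injective := by
    rintro ⟨f, hf⟩ ⟨g, hg⟩ h
    have : f = g := DFunLike.coe_injective h
    subst this
    rfl

instance {A B : Type*} [OperatorAlgebra A] [OperatorAlgebra B] :
    NonUnitalAlgHomClass (OAHom A B) ℂ A B where
  map_add f := map_add f.toNonUnitalAlgHom
  map_mul f := map_mul f.toNonUnitalAlgHom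
  map_zero f := map_zero f.toNonUnitalAlgHom
  map_smulₛₗ f := map_smul f.toNonUnitalAlgHom

/-- A completely isometric morphism. -/
def OAHom.IsCompleteIsometry {A B : Type*} [OperatorAlgebra A] [OperatorAlgebra B]
    (f : OAHom A B) : Prop :=
  ∀ (n : ℕ) (M : Matrix (Fin n) (Fin n) A), matrixNorm (M.map f) = matrixNorm M

/-- A complete quotient map: at every matrix level, the open unit ball is mapped onto the open
unit ball. -/
def OAHom.IsCompleteQuotientMap {A B : Type*} [OperatorAlgebra A] [OperatorAlgebra B]
    (f : OAHom A B) : Prop :=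
  ∀ n : ℕ, (fun M : Matrix (Fin n) (Fin n) A => M.map f) '' {M | matrixNorm M < 1} =
    {N : Matrix (Fin n) (Fin n) B | matrixNorm N < 1}

/-- A contractive two-sided approximate identity (cai), as a filter on the algebra. -/
structure IsCai {A : Type*} [OperatorAlgebra A] (l : Filter A) : Prop where
  isApproximateUnit : l.IsApproximateUnit
  contractive : ∀ᶠ e in l, ‖e‖ ≤ 1

/-- An operator algebra is approximately unital if it has a cai. -/
class ApproximatelyUnital (A : Type*) [OperatorAlgebra A] : Prop where
  exists_cai : ∃ l : Filter A, IsCai l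

/-- A morphism is proper if it takes some cai to a cai. -/
def OAHom.IsProper {A B : Type*} [OperatorAlgebra A] [OperatorAlgebra B] (f : OAHom A B) : Prop :=
  ∃ l : Filter A, IsCai l ∧ IsCai (l.map f)

/-! ### Basic facts on norms -/

section Norms

variable {A B : Type*} [OperatorAlgebra A] [OperatorAlgebra B]

theorem matrixOperator_apply {H : Type*} [NormedAddCommGroup H] [InnerProductSpace ℂ H] {n : ℕ}
    (T : Matrix (Fin n) (Fin n) (H →L[ℂ] H)) (x : PiLp 2 (fun _ : Fin n => H)) (i : Fin n) :
    matrixOperator T x i = ∑ j, T i j (x j) := by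
  simp [matrixOperator]

theorem matrixNorm_one_eq (a : A) :
    matrixNorm (Matrix.of fun _ _ : Fin 1 => a) = ‖a‖ := by
  obtain ⟨H, _, _, _, π, h1, h2⟩ := OperatorAlgebra.exists_representation (A := A)
  rw [h2, ← h1]
  have key : ∀ y : PiLp 2 (fun _ : Fin 1 => H), ‖y‖ = ‖y 0‖ := by
    intro y
    rw [PiLp.norm_eq_of_L2]
    simp
  apply le_antisymm
  · refine ContinuousLinearMap.opNorm_le_bound _ (norm_nonneg _) fun x => ?_
    rw [key, key x, matrixOperator_apply]
    simpa using (π a).le_opNorm (x 0)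
  · refine ContinuousLinearMap.opNorm_le_bound _ (norm_nonneg _) fun x => ?_
    have := (matrixOperator ((Matrix.of fun _ _ : Fin 1 => a).map π)).le_opNorm
      (WithLp.toLp 2 fun _ : Fin 1 => x)
    rw [key, key (WithLp.toLp 2 fun _ : Fin 1 => x), matrixOperator_apply] at this
    simpa using this

theorem matrixNorm_smul {n : ℕ} (c : ℂ) (M : Matrix (Fin n) (Fin n) A) :
    matrixNorm (c • M) = ‖c‖ * matrixNorm M := by
  obtain ⟨H, _, _, _, π, h1, h2⟩ := OperatorAlgebra.exists_representation (A := A)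
  rw [h2, h2, ← norm_smul]
  congr 1
  ext x i
  simp [matrixOperator_apply, Finset.smul_sum]

theorem OAHom.norm_map_le (f : OAHom A B) (a : A) : ‖f a‖ ≤ ‖a‖ := by
  rw [← matrixNorm_one_eq, ← matrixNorm_one_eq a]
  exact f.completely_contractive 1 (Matrix.of fun _ _ : Fin 1 => a)

theorem OAHom.IsCompleteIsometry.norm_map {f : OAHom A B} (hf : f.IsCompleteIsometry) (a : A) :
    ‖f a‖ = ‖a‖ := by
  rw [← matrixNorm_one_eq, ← matrixNorm_one_eq a]
  exact hf 1 (Matrix.of fun _ _ : Fin 1 => a)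

theorem OAHom.IsCompleteIsometry.injective {f : OAHom A B} (hf : f.IsCompleteIsometry) :
    Function.Injective f := by
  intro a b hab
  have := hf.norm_map (a - b)
  rw [map_sub, hab, sub_self, norm_zero] at this
  exact sub_eq_zero.mp (norm_eq_zero.mp this.symm)

theorem OAHom.IsCompleteQuotientMap.surjective {f : OAHom A B} (hf : f.IsCompleteQuotientMap) :
    Function.Surjective f := by
  intro b
  have hpos : (0 : ℝ) < ‖b‖ + 1 := by positivity
  have hne : ((‖b‖ + 1 : ℝ) : ℂ) ≠ 0 := by exact_mod_cast hpos.ne'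
  have hmem : (Matrix.of fun _ _ : Fin 1 => ((‖b‖ + 1 : ℝ) : ℂ)⁻¹ • b) ∈
      {N : Matrix (Fin 1) (Fin 1) B | matrixNorm N < 1} := by
    rw [Set.mem_ofPred_eq, matrixNorm_one_eq, norm_smul, norm_inv, Complex.norm_real,
      Real.norm_of_nonneg hpos.le, inv_mul_lt_iff₀ hpos]
    linarith
  rw [← hf 1] at hmem
  obtain ⟨M, -, hM⟩ := hmem
  have h0 := congrFun (congrFun hM 0) 0
  simp only [Matrix.map_apply, Matrix.of_apply] at h0
  exact ⟨((‖b‖ + 1 : ℝ) : ℂ) • M 0 0, by rw [map_smul, h0, smul_inv_smul₀ hne]⟩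

end Norms

/-! ### Multipliers and the corona algebra -/

section Multipliers

variable {A : Type*} [OperatorAlgebra A]

theorem eq_of_mul_left_eq [ApproximatelyUnital A] {a b : A} (h : ∀ c, c * a = c * b) : a = b := by
  obtain ⟨l, hl⟩ := ApproximatelyUnital.exists_cai (A := A)
  have := hl.isApproximateUnit.neBot
  have h1 := hl.isApproximateUnit.tendsto_mul_right a
  have h2 := hl.isApproximateUnit.tendsto_mul_right b
  simp only [h] at h1
  exact tendsto_nhds_unique h1 h2

theorem eq_of_mul_right_eq [ApproximatelyUnital A] {a b : A} (h : ∀ c, a * c = b * c) : a = b := by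
  obtain ⟨l, hl⟩ := ApproximatelyUnital.exists_cai (A := A)
  have := hl.isApproximateUnit.neBot
  have h1 := hl.isApproximateUnit.tendsto_mul_left a
  have h2 := hl.isApproximateUnit.tendsto_mul_left b
  simp only [h] at h1
  exact tendsto_nhds_unique h1 h2

/-- In the multiplier algebra `𝓜(ℂ, A)` of double centralizers, `x.fst a` is the product `x a`. -/
theorem multiplier_fst_mul [ApproximatelyUnital A] (x : 𝓜(ℂ, A)) (a b : A) :
    x.fst (a * b) = x.fst a * b :=
  eq_of_mul_left_eq fun c => by rw [← x.central, ← mul_assoc, x.central, mul_assoc]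

/-- In the multiplier algebra `𝓜(ℂ, A)` of double centralizers, `x.snd a` is the product `a x`. -/
theorem multiplier_snd_mul [ApproximatelyUnital A] (x : 𝓜(ℂ, A)) (a b : A) :
    x.snd (a * b) = a * x.snd b :=
  eq_of_mul_right_eq fun c => by rw [x.central, mul_assoc, mul_assoc, x.central]

theorem multiplier_ext {x y : 𝓜(ℂ, A)} (h1 : ∀ a, x.fst a = y.fst a)
    (h2 : ∀ a, x.snd a = y.snd a) : x = y :=
  DoubleCentralizer.ext _ _ _ _
    (Prod.ext (ContinuousLinearMap.ext h1) (ContinuousLinearMap.ext h2))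

variable (A)

/-- The image of an approximately unital operator algebra `A` in its multiplier algebra, a
two-sided ideal. -/
def multiplierIdeal [ApproximatelyUnital A] : TwoSidedIdeal 𝓜(ℂ, A) :=
  TwoSidedIdeal.mk' (Set.range fun a : A => DoubleCentralizer.coe ℂ a)
    ⟨0, multiplier_ext (fun a => by simp)
      (fun a => by simp)⟩
    (by
      rintro _ _ ⟨a, rfl⟩ ⟨b, rfl⟩
      exact ⟨a + b, multiplier_ext (fun c => by simp)
        (fun c => by simp)⟩)
    (by
      rintro _ ⟨a, rfl⟩
      exact ⟨-a, multiplier_ext (fun c => by simp)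
        (fun c => by simp)⟩)
    (by
      rintro x _ ⟨a, rfl⟩
      exact ⟨x.fst a, multiplier_ext (fun c => by simp [multiplier_fst_mul])
        (fun c => by simp [x.central])⟩)
    (by
      rintro _ x ⟨a, rfl⟩
      exact ⟨x.snd a, multiplier_ext (fun c => by simp [x.central])
        (fun c => by simp [multiplier_snd_mul])⟩)

/-- The corona algebra `𝓜(A) / A`, a unital complex algebra. -/
abbrev CoronaAlgebra [ApproximatelyUnital A] : Type _ :=
  (multiplierIdeal A).ringCon.Quotient

/-- The canonical map `𝓜(A) → 𝓜(A) / A`. -/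
def coronaMk [ApproximatelyUnital A] : 𝓜(ℂ, A) →ₐ[ℂ] CoronaAlgebra A :=
  (multiplierIdeal A).ringCon.mkₐ ℂ

variable {A}

theorem mem_multiplierIdeal [ApproximatelyUnital A] {x : 𝓜(ℂ, A)} :
    x ∈ multiplierIdeal A ↔ ∃ a : A, DoubleCentralizer.coe ℂ a = x := 
  TwoSidedIdeal.mem_mk' _ _ _ _ _ _ _

theorem coronaMk_eq_iff [ApproximatelyUnital A] {x y : 𝓜(ℂ, A)} :
    coronaMk A x = coronaMk A y ↔ ∃ a : A, DoubleCentralizer.coe ℂ a = x - y := by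
  rw [← mem_multiplierIdeal, ← TwoSidedIdeal.rel_iff]
  exact RingCon.eq _

end Multipliers

/-! ### The extension of a proper morphism to multiplier algebras and corona algebras -/

/-- Strong convergence of a bounded family of operators along a filter follows from convergence
on a dense set. -/
theorem exists_limit_operator {A B : Type*} [OperatorAlgebra B] {l : Filter A} [l.NeBot] (T : A → B →L[ℂ] B) (C : ℝ) (hC : 0 ≤ C)
    (hT : ∀ᶠ e in l, ‖T e‖ ≤ C) (D : Set B) (hD : Dense D)
    (hconv : ∀ b ∈ D, ∃ y, Tendsto (fun e => T e b) l (𝓝 y)) :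
    ∃ S : B →L[ℂ] B, ∀ b, Tendsto (fun e => T e b) l (𝓝 (S b)) := by
  have hall : ∀ b, ∃ y, Tendsto (fun e => T e b) l (𝓝 y) := by
    intro b
    apply cauchy_map_iff_exists_tendsto.mp
    rw [Metric.cauchy_iff]
    refine ⟨inferInstance, fun ε hε => ?_⟩
    obtain ⟨d, hd, hbd⟩ := Metric.dense_iff.mp hD b (ε / (4 * (C + 1))) (by positivity)
    obtain ⟨y, hy⟩ := hconv d hbd
    have hy' := (Metric.tendsto_nhds.mp hy) (ε / 4) (by positivity)
    refine ⟨Metric.ball y (ε / 2), ?_, ?_⟩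
    · rw [mem_map]
      filter_upwards [hT, hy'] with e h1 h2
      rw [Set.mem_preimage, Metric.mem_ball]
      have h3 : dist (T e b) (T e d) ≤ ε / 4 := by
        rw [dist_eq_norm, ← map_sub]
        have h4 : ‖b - d‖ ≤ ε / (4 * (C + 1)) := by
          rw [← dist_eq_norm, dist_comm]; exact (Metric.mem_ball.mp hd).le
        calc ‖T e (b - d)‖ ≤ ‖T e‖ * ‖b - d‖ := (T e).le_opNorm _
          _ ≤ (C + 1) * (ε / (4 * (C + 1))) := by gcongr; linarith
          _ = ε / 4 := by field_simp
      linarith [dist_triangle (T e b) (T e d) y]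
    · intro u hu v hv
      rw [Metric.mem_ball] at hu hv
      linarith [dist_triangle_right u v y]
  choose S hS using hall
  refine ⟨LinearMap.mkContinuous
    { toFun := S
      map_add' := fun b c => tendsto_nhds_unique (hS (b + c))
        (((hS b).add (hS c)).congr fun e => (map_add (T e) b c).symm)
      map_smul' := fun k b => tendsto_nhds_unique (hS (k • b))
        (((hS b).const_smul k).congr fun e => (map_smul (T e) k b).symm) } C ?_, fun b => hS b⟩
  intro b
  refine le_of_tendsto (hS b).norm ?_
  filter_upwards [hT] with e he
  exact (T e).le_of_opNorm_le he b

section ProperExtension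

variable {A B : Type*} [OperatorAlgebra A] [OperatorAlgebra B]

theorem OAHom.IsProper.dense_left {f : OAHom A B} (hf : f.IsProper) :
    Dense {b : B | ∃ a c, b = f a * c} := by
  obtain ⟨l, -, hl⟩ := hf
  intro b
  have hne := hl.isApproximateUnit.neBot
  refine mem_closure_of_tendsto (hl.isApproximateUnit.tendsto_mul_right b) ?_
  rw [eventually_map]
  exact Eventually.of_forall fun e => ⟨e, b, rfl⟩

theorem OAHom.IsProper.dense_right {f : OAHom A B} (hf : f.IsProper) :
    Dense {b : B | ∃ c a, b = c * f a} := by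
  obtain ⟨l, -, hl⟩ := hf
  intro b
  have hne := hl.isApproximateUnit.neBot
  refine mem_closure_of_tendsto (hl.isApproximateUnit.tendsto_mul_left b) ?_
  rw [eventually_map]
  exact Eventually.of_forall fun e => ⟨b, e, rfl⟩

variable [ApproximatelyUnital B]

/-- A multiplier `y` of `B` is determined by its products with the elements `f a`, if `f : A → B`
is proper. -/
theorem OAHom.IsProper.multiplier_ext {f : OAHom A B} (hf : f.IsProper) {y z : 𝓜(ℂ, B)}
    (h1 : ∀ a, y.fst (f a) = z.fst (f a)) (h2 : ∀ a, y.snd (f a) = z.snd (f a)) : y = z := by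
  refine _root_.multiplier_ext (fun b => ?_) (fun b => ?_)
  · refine congrFun (Continuous.ext_on hf.dense_left y.fst.continuous z.fst.continuous ?_) b
    rintro _ ⟨a, c, rfl⟩
    rw [multiplier_fst_mul, multiplier_fst_mul, h1]
  · refine congrFun (Continuous.ext_on hf.dense_right y.snd.continuous z.snd.continuous ?_) b
    rintro _ ⟨c, a, rfl⟩
    rw [multiplier_snd_mul, multiplier_snd_mul, h2]

variable [ApproximatelyUnital A]

/-- If `f : A → B` is a proper morphism then for each multiplier `x` of `A` there is a
multiplier `y` of `B` with `y (f a) = f (x a)` and `(f a) y = f (a x)` for all `a`. It is unique by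
`OAHom.IsProper.multiplier_ext`. -/
theorem OAHom.IsProper.exists_multiplier {f : OAHom A B} (hf : f.IsProper) (x : 𝓜(ℂ, A)) :
    ∃ y : 𝓜(ℂ, B), (∀ a, y.fst (f a) = f (x.fst a)) ∧ ∀ a, y.snd (f a) = f (x.snd a) := by
  have hfc : Continuous f :=
    AddMonoidHomClass.continuous_of_bound f 1 fun a => by simpa using f.norm_map_le a
  obtain ⟨l, hl, hl'⟩ := id hf
  have hne := hl.isApproximateUnit.neBot
  obtain ⟨S, hS⟩ := exists_limit_operator (l := l)
    (fun e => ContinuousLinearMap.mul ℂ B (f (x.fst e))) ‖x.fst‖ (norm_nonneg _)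
    (by
      filter_upwards [hl.contractive] with e he
      refine (ContinuousLinearMap.opNorm_mul_apply_le _ _ _).trans ((f.norm_map_le _).trans ?_)
      simpa using x.fst.le_of_opNorm_le_of_le le_rfl he)
    _ hf.dense_left
    (by
      rintro _ ⟨a, c, rfl⟩
      refine ⟨f (x.fst a) * c, ?_⟩
      have h := ((hfc.comp x.fst.continuous).tendsto a).comp
        (hl.isApproximateUnit.tendsto_mul_right a)
      refine (h.mul_const c).congr fun e => ?_
      simp [multiplier_fst_mul, mul_assoc])
  obtain ⟨R, hR⟩ := exists_limit_operator (l := l)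
    (fun e => (ContinuousLinearMap.mul ℂ B).flip (f (x.snd e))) ‖x.snd‖ (norm_nonneg _)
    (by
      filter_upwards [hl.contractive] with e he
      refine ContinuousLinearMap.opNorm_le_bound _ (norm_nonneg _) fun b => ?_
      have h1 : ‖f (x.snd e)‖ ≤ ‖x.snd‖ := (f.norm_map_le _).trans
        (by simpa using x.snd.le_of_opNorm_le_of_le le_rfl he)
      calc ‖b * f (x.snd e)‖ ≤ ‖b‖ * ‖f (x.snd e)‖ := norm_mul_le _ _
        _ ≤ ‖b‖ * ‖x.snd‖ := by gcongr
        _ = ‖x.snd‖ * ‖b‖ := mul_comm _ _)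
    _ hf.dense_right
    (by
      rintro _ ⟨c, a, rfl⟩
      refine ⟨c * f (x.snd a), ?_⟩
      have h := ((hfc.comp x.snd.continuous).tendsto a).comp
        (hl.isApproximateUnit.tendsto_mul_left a)
      refine (h.const_mul c).congr fun e => ?_
      simp [multiplier_snd_mul, mul_assoc])
  have hSf : ∀ a, S (f a) = f (x.fst a) := fun a => by
    refine tendsto_nhds_unique (hS (f a)) ?_
    refine (((hfc.comp x.fst.continuous).tendsto a).comp
      (hl.isApproximateUnit.tendsto_mul_right a)).congr fun e => ?_
    simp [multiplier_fst_mul]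
  have hRf : ∀ a, R (f a) = f (x.snd a) := fun a => by
    refine tendsto_nhds_unique (hR (f a)) ?_
    refine (((hfc.comp x.snd.continuous).tendsto a).comp
      (hl.isApproximateUnit.tendsto_mul_left a)).congr fun e => ?_
    simp [multiplier_snd_mul]
  have hSm : ∀ b c, S (b * c) = S b * c := fun b c => by
    refine tendsto_nhds_unique (hS (b * c)) (((hS b).mul_const c).congr fun e => ?_)
    simp [mul_assoc]
  have hRm : ∀ b c, R (b * c) = b * R c := fun b c => by
    refine tendsto_nhds_unique (hR (b * c)) (((hR c).const_mul b).congr fun e => ?_)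
    simp [mul_assoc]
  refine ⟨⟨(S, R), fun b c => ?_⟩, hSf, hRf⟩
  show R b * c = b * S c
  have hc : ∀ a c', R b * (f a * c') = b * S (f a * c') := by
    intro a c'
    refine congrFun (Continuous.ext_on hf.dense_right
      (f := fun b => R b * (f a * c')) (g := fun b => b * S (f a * c'))
      (R.continuous.mul continuous_const) (continuous_id.mul continuous_const) ?_) b
    rintro _ ⟨b', a', rfl⟩
    show R (b' * f a') * (f a * c') = b' * f a' * S (f a * c')
    rw [hRm, hRf, hSm, hSf, mul_assoc, mul_assoc, ← mul_assoc (f (x.snd a')), ← map_mul,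
      x.central, map_mul, mul_assoc]
  refine congrFun (Continuous.ext_on hf.dense_left
    (f := fun c => R b * c) (g := fun c => b * S c)
    (continuous_const.mul continuous_id) (continuous_const.mul S.continuous) ?_) c
  rintro _ ⟨a, c', rfl⟩
  exact hc a c'

/-- The canonical extension `𝓜(A) → 𝓜(B)` of a proper morphism `f : A → B`: it sends `x` to the
unique multiplier `y` of `B` with `y (f a) = f (x a)` and `(f a) y = f (a x)` for all `a`. -/
def multiplierMap (f : OAHom A B) (hf : f.IsProper) : 𝓜(ℂ, A) →ₐ[ℂ] 𝓜(ℂ, B) :=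
  AlgHom.ofLinearMap
    { toFun := fun x => (hf.exists_multiplier x).choose
      map_add' := fun x y => by
        have hx := (hf.exists_multiplier x).choose_spec
        have hy := (hf.exists_multiplier y).choose_spec
        have hxy := (hf.exists_multiplier (x + y)).choose_spec
        refine hf.multiplier_ext (fun a => ?_) (fun a => ?_)
        · rw [hxy.1, DoubleCentralizer.add_fst, DoubleCentralizer.add_fst,
            add_apply, add_apply, hx.1, hy.1, map_add]
        · rw [hxy.2, DoubleCentralizer.add_snd, DoubleCentralizer.add_snd,
            add_apply, add_apply, hx.2, hy.2, map_add]
      map_smul' := fun k x => by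
        have hx := (hf.exists_multiplier x).choose_spec
        have hkx := (hf.exists_multiplier (k • x)).choose_spec
        refine hf.multiplier_ext (fun a => ?_) (fun a => ?_)
        · rw [hkx.1, RingHom.id_apply, DoubleCentralizer.smul_fst, DoubleCentralizer.smul_fst,
            smul_apply, smul_apply, hx.1, map_smul]
        · rw [hkx.2, RingHom.id_apply, DoubleCentralizer.smul_snd, DoubleCentralizer.smul_snd,
            smul_apply, smul_apply, hx.2, map_smul] }
    (by
      have h1 := (hf.exists_multiplier 1).choose_spec
      refine hf.multiplier_ext (fun a => ?_) (fun a => ?_)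
      · exact h1.1 a
      · exact h1.2 a)
    (fun x y => by
      have hx := (hf.exists_multiplier x).choose_spec
      have hy := (hf.exists_multiplier y).choose_spec
      have hxy := (hf.exists_multiplier (x * y)).choose_spec
      refine hf.multiplier_ext (fun a => ?_) (fun a => ?_)
      · refine (hxy.1 a).trans ?_
        show f (x.fst (y.fst a)) = (hf.exists_multiplier x).choose.fst
          ((hf.exists_multiplier y).choose.fst (f a))
        rw [hy.1, hx.1]
      · refine (hxy.2 a).trans ?_
        show f (y.snd (x.snd a)) = (hf.exists_multiplier y).choose.snd
          ((hf.exists_multiplier x).choose.snd (f a))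
        rw [hx.2, hy.2])

theorem multiplierMap_fst (f : OAHom A B) (hf : f.IsProper) (x : 𝓜(ℂ, A)) (a : A) :
    (multiplierMap f hf x).fst (f a) = f (x.fst a) :=
  (hf.exists_multiplier x).choose_spec.1 a

theorem multiplierMap_snd (f : OAHom A B) (hf : f.IsProper) (x : 𝓜(ℂ, A)) (a : A) :
    (multiplierMap f hf x).snd (f a) = f (x.snd a) :=
  (hf.exists_multiplier x).choose_spec.2 a

/-- `multiplierMap f hf` extends `f`. -/
theorem multiplierMap_coe (f : OAHom A B) (hf : f.IsProper) (a : A) :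
    multiplierMap f hf (DoubleCentralizer.coe ℂ a) = DoubleCentralizer.coe ℂ (f a) :=
  hf.multiplier_ext (fun c => by rw [multiplierMap_fst]; simp)
    (fun c => by rw [multiplierMap_snd]; simp)

/-- The unital homomorphism `𝓜(A) / A → 𝓜(B) / B` induced by a proper morphism `f : A → B`, via
its canonical extension `𝓜(A) → 𝓜(B)`. -/
def coronaMap (f : OAHom A B) (hf : f.IsProper) : CoronaAlgebra A →ₐ[ℂ] CoronaAlgebra B :=
  (multiplierIdeal A).ringCon.liftₐ ((coronaMk B).comp (multiplierMap f hf)) (by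
    intro x y hxy
    rw [TwoSidedIdeal.rel_iff, mem_multiplierIdeal] at hxy
    obtain ⟨a, ha⟩ := hxy
    show coronaMk B (multiplierMap f hf x) = coronaMk B (multiplierMap f hf y)
    rw [coronaMk_eq_iff]
    exact ⟨f a, by rw [← map_sub, ← ha, multiplierMap_coe]⟩)

theorem coronaMap_mk (f : OAHom A B) (hf : f.IsProper) (x : 𝓜(ℂ, A)) :
    coronaMap f hf (coronaMk A x) = coronaMk B (multiplierMap f hf x) := rfl

end ProperExtension

/-! ### Extensions and the Busby invariant -/

/-- An extension `0 → A → B → C → 0` of operator algebras: an exact sequence of morphisms whose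
first map is completely isometric and whose second map is a complete quotient map. -/
structure OAExtension (A B C : Type*) [OperatorAlgebra A] [OperatorAlgebra B]
    [OperatorAlgebra C] where
  /-- The embedding of the ideal. -/
  incl : OAHom A B
  /-- The quotient map. -/
  proj : OAHom B C
  incl_isCompleteIsometry : incl.IsCompleteIsometry
  proj_isCompleteQuotientMap : proj.IsCompleteQuotientMap
  exact : ∀ b : B, proj b = 0 ↔ ∃ a : A, incl a = b

namespace OAExtension

variable {A B C : Type*} [OperatorAlgebra A] [OperatorAlgebra B] [OperatorAlgebra C]
  (E : OAExtension A B C)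

theorem proj_incl (a : A) : E.proj (E.incl a) = 0 := (E.exact _).mpr ⟨a, rfl⟩

theorem exists_left (b : B) (a : A) : ∃ c : A, E.incl c = b * E.incl a :=
  (E.exact _).mp (by rw [map_mul, proj_incl, mul_zero])

theorem exists_right (b : B) (a : A) : ∃ c : A, E.incl c = E.incl a * b :=
  (E.exact _).mp (by rw [map_mul, proj_incl, zero_mul])

/-- `σ(b) a = α⁻¹(b α(a))`, where `α : A → B` is the embedding. -/
def leftMul (b : B) : A →L[ℂ] A :=
  LinearMap.mkContinuous
    { toFun := fun a => (E.exists_left b a).choose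
      map_add' := fun a a' => E.incl_isCompleteIsometry.injective
        ((E.exists_left b _).choose_spec.trans (by
          rw [map_add, map_add, mul_add, (E.exists_left b _).choose_spec, (E.exists_left b _).choose_spec]))
      map_smul' := fun k a => E.incl_isCompleteIsometry.injective
        ((E.exists_left b _).choose_spec.trans (by
          rw [RingHom.id_apply, map_smul, map_smul, mul_smul_comm, (E.exists_left b _).choose_spec])) } ‖b‖ (fun a => by
      rw [← E.incl_isCompleteIsometry.norm_map, ← E.incl_isCompleteIsometry.norm_map a]
      show ‖E.incl (E.exists_left b a).choose‖ ≤ _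
      rw [(E.exists_left b a).choose_spec]
      exact norm_mul_le _ _)

/-- `a σ(b) = α⁻¹(α(a) b)`, where `α : A → B` is the embedding. -/
def rightMul (b : B) : A →L[ℂ] A :=
  LinearMap.mkContinuous
    { toFun := fun a => (E.exists_right b a).choose
      map_add' := fun a a' => E.incl_isCompleteIsometry.injective
        ((E.exists_right b _).choose_spec.trans (by
          rw [map_add, map_add, add_mul, (E.exists_right b _).choose_spec, (E.exists_right b _).choose_spec]))
      map_smul' := fun k a => E.incl_isCompleteIsometry.injective
        ((E.exists_right b _).choose_spec.trans (by
          rw [RingHom.id_apply, map_smul, map_smul, smul_mul_assoc, (E.exists_right b _).choose_spec])) } ‖b‖ (fun a => by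
      rw [← E.incl_isCompleteIsometry.norm_map, ← E.incl_isCompleteIsometry.norm_map a]
      show ‖E.incl (E.exists_right b a).choose‖ ≤ _
      rw [(E.exists_right b a).choose_spec, mul_comm ‖b‖]
      exact norm_mul_le _ _)

theorem incl_leftMul (b : B) (a : A) : E.incl (E.leftMul b a) = b * E.incl a :=
  (E.exists_left b a).choose_spec

theorem incl_rightMul (b : B) (a : A) : E.incl (E.rightMul b a) = E.incl a * b :=
  (E.exists_right b a).choose_spec

/-- The multiplier `σ(b)` of `A` given by `b`. -/
def sigmaFun (b : B) : 𝓜(ℂ, A) where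
  fst := E.leftMul b
  snd := E.rightMul b
  central := fun a c => E.incl_isCompleteIsometry.injective (by
    rw [map_mul, map_mul, incl_leftMul, incl_rightMul, mul_assoc])

/-- The canonical homomorphism `σ : B → 𝓜(A)` of an extension. -/
def sigma : B →ₙₐ[ℂ] 𝓜(ℂ, A) where
  toFun := E.sigmaFun
  map_zero' := multiplier_ext
    (fun a => E.incl_isCompleteIsometry.injective (by
      show E.incl (E.leftMul 0 a) = E.incl 0
      rw [incl_leftMul, map_zero, zero_mul]))
    (fun a => E.incl_isCompleteIsometry.injective (by
      show E.incl (E.rightMul 0 a) = E.incl 0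
      rw [incl_rightMul, map_zero, mul_zero]))
  map_add' := fun b c => multiplier_ext
    (fun a => E.incl_isCompleteIsometry.injective (by
      show E.incl (E.leftMul (b + c) a) = E.incl (E.leftMul b a + E.leftMul c a)
      rw [map_add, incl_leftMul, incl_leftMul, incl_leftMul, add_mul]))
    (fun a => E.incl_isCompleteIsometry.injective (by
      show E.incl (E.rightMul (b + c) a) = E.incl (E.rightMul b a + E.rightMul c a)
      rw [map_add, incl_rightMul, incl_rightMul, incl_rightMul, mul_add]))
  map_smul' := fun k b => multiplier_ext
    (fun a => E.incl_isCompleteIsometry.injective (by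
      show E.incl (E.leftMul (k • b) a) = E.incl (k • E.leftMul b a)
      rw [map_smul, incl_leftMul, incl_leftMul, smul_mul_assoc]))
    (fun a => E.incl_isCompleteIsometry.injective (by
      show E.incl (E.rightMul (k • b) a) = E.incl (k • E.rightMul b a)
      rw [map_smul, incl_rightMul, incl_rightMul, mul_smul_comm]))
  map_mul' := fun b c => multiplier_ext
    (fun a => E.incl_isCompleteIsometry.injective (by
      show E.incl (E.leftMul (b * c) a) = E.incl (E.leftMul b (E.leftMul c a))
      rw [incl_leftMul, incl_leftMul, incl_leftMul, mul_assoc]))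
    (fun a => E.incl_isCompleteIsometry.injective (by
      show E.incl (E.rightMul (b * c) a) = E.incl (E.rightMul c (E.rightMul b a))
      rw [incl_rightMul, incl_rightMul, incl_rightMul, mul_assoc]))

theorem sigma_incl (a : A) : E.sigma (E.incl a) = DoubleCentralizer.coe ℂ a :=
  multiplier_ext
    (fun c => E.incl_isCompleteIsometry.injective (by
      show E.incl (E.leftMul (E.incl a) c) = E.incl (a * c)
      rw [incl_leftMul, map_mul]))
    (fun c => E.incl_isCompleteIsometry.injective (by
      show E.incl (E.rightMul (E.incl a) c) = E.incl (c * a)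
      rw [incl_rightMul, map_mul]))

theorem proj_surjInv (c : C) :
    E.proj (Function.surjInv E.proj_isCompleteQuotientMap.surjective c) = c :=
  Function.surjInv_eq _ c

variable [ApproximatelyUnital A]

theorem coronaMk_sigma_eq {b b' : B} (h : E.proj b = E.proj b') :
    coronaMk A (E.sigma b) = coronaMk A (E.sigma b') := by
  rw [coronaMk_eq_iff]
  obtain ⟨a, ha⟩ := (E.exact (b - b')).mp (by rw [map_sub, h, sub_self])
  exact ⟨a, (E.sigma_incl a).symm.trans (by rw [ha, map_sub])⟩

/-- The Busby invariant `τ : C → 𝓜(A) / A` of an extension: `τ(c)` is the class of `σ(b)`, for any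
`b` that is mapped to `c`. -/
def busby : C →ₙₐ[ℂ] CoronaAlgebra A where
  toFun := fun c =>
    coronaMk A (E.sigma (Function.surjInv E.proj_isCompleteQuotientMap.surjective c))
  map_zero' := by
    refine (E.coronaMk_sigma_eq (b' := 0) (by rw [proj_surjInv, map_zero])).trans ?_
    rw [map_zero, map_zero]
  map_add' := fun c d => by
    rw [← map_add, ← map_add]
    exact E.coronaMk_sigma_eq (by rw [map_add]; simp only [proj_surjInv])
  map_smul' := fun k c => by
    rw [MonoidHom.id_apply, ← map_smul, ← map_smul]
    exact E.coronaMk_sigma_eq (by rw [map_smul]; simp only [proj_surjInv])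
  map_mul' := fun c d => by
    rw [← map_mul, ← map_mul]
    exact E.coronaMk_sigma_eq (by rw [map_mul]; simp only [proj_surjInv])

theorem busby_proj (b : B) : E.busby (E.proj b) = coronaMk A (E.sigma b) :=
  E.coronaMk_sigma_eq (by rw [proj_surjInv])

end OAExtension

/-- `ρ` makes the diagram with rows the extensions `E₁`, `E₂` and outer vertical arrows `μ`, `ν`
commute. -/
def IsExtensionMorphism {A₁ B₁ C₁ A₂ B₂ C₂ : Type*}
    [OperatorAlgebra A₁] [OperatorAlgebra B₁] [OperatorAlgebra C₁]
    [OperatorAlgebra A₂] [OperatorAlgebra B₂] [OperatorAlgebra C₂]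
    (E₁ : OAExtension A₁ B₁ C₁) (E₂ : OAExtension A₂ B₂ C₂)
    (μ : OAHom A₁ A₂) (ρ : OAHom B₁ B₂) (ν : OAHom C₁ C₂) : Prop :=
  (∀ a, ρ (E₁.incl a) = E₂.incl (μ a)) ∧ ∀ b, E₂.proj (ρ b) = ν (E₁.proj b)

end

/-! Algebraically, `(σ, β)` identifies the middle algebra `B` with the pullback of `𝓜(A) → 𝓜(A)/A ←
C` (`eq_of_sigma_eq_of_proj_eq`, `exists_sigma_eq_and_proj_eq`). Properness makes a multiplier of
`A₂` determined by its products with `μ(A₁)`, so any `ρ` completing the diagram satisfies `σ₂ ∘ ρ =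
μ̄ ∘ σ₁` and `β₂ ∘ ρ = ν ∘ β₁`. This gives uniqueness, and reducing modulo `A₂` gives necessity of
the Busby condition. Conversely, that condition says exactly that `(μ̄(σ₁ b), ν(β₁ b))` lies in the
second pullback, so it defines a homomorphism `ρ`.

The analytic point is that `ρ` is completely contractive. By `matrixNorm_le`, a matrix norm on `B`
is at most any common bound for the action on a cai of `A` and for the quotient norm in `C`. Indeed,
in a representation of `B` on `H`, the limit of the cai cuts out a reducing subspace `K` on which
`A` acts nondegenerately. On `K` the action on `A` controls the norm; on `Kᗮ` the ideal acts by zero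
and the representation factors through `C`. For `ρ`, complete contractivity of `μ` bounds the first
part and that of `ν` the second. -/

open OperatorAlgebra (matrixNorm)
open scoped InnerProductSpace

/-! ### Nets of contractions on a Hilbert space. -/

section Hilbert

variable {ι H : Type*} [NormedAddCommGroup H] [InnerProductSpace ℂ H]

/-- If a net of contractions fixes a vector in the limit, then so does the net of adjoints. -/
theorem tendsto_of_tendsto_adjoint [CompleteSpace H] {l : Filter ι} {T : ι → H →L[ℂ] H}
    (hT : ∀ᶠ i in l, ‖T i‖ ≤ 1) {y : H}
    (h : Tendsto (fun i => ContinuousLinearMap.adjoint (T i) y) l (𝓝 y)) :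
    Tendsto (fun i => T i y) l (𝓝 y) := by
  rw [tendsto_iff_norm_sub_tendsto_zero]
  -- Expanding the square and using `‖T y‖ ≤ ‖y‖` bounds `‖T y - y‖ ^ 2` by this quantity.
  have h1 : Tendsto (fun i => 2 * ‖y‖ ^ 2 -
      2 * RCLike.re ⟪y, ContinuousLinearMap.adjoint (T i) y⟫_ℂ) l (𝓝 0) := by
    have h2 : Tendsto (fun i => RCLike.re ⟪y, ContinuousLinearMap.adjoint (T i) y⟫_ℂ) l
        (𝓝 (RCLike.re ⟪y, y⟫_ℂ)) :=
      (RCLike.continuous_re.tendsto _).comp (tendsto_const_nhds.inner h)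
    have h3 := (h2.const_mul 2).const_sub (2 * ‖y‖ ^ 2)
    rwa [inner_self_eq_norm_sq, sub_self] at h3
  have h4 : Tendsto (fun i => ‖T i y - y‖ ^ 2) l (𝓝 0) := by
    refine squeeze_zero' (Eventually.of_forall fun i => by positivity) ?_ h1
    filter_upwards [hT] with i hi
    have h5 : ‖T i y‖ ≤ ‖y‖ := by simpa using (T i).le_of_opNorm_le hi y
    rw [norm_sub_sq (𝕜 := ℂ), ContinuousLinearMap.adjoint_inner_right]
    nlinarith [norm_nonneg (T i y)]
  simpa using h4.sqrt

/-- The closed subspace of vectors fixed in the limit by a net of contractions. -/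
def asymptoticFixedSubmodule (l : Filter ι) (T : ι → H →L[ℂ] H) : Submodule ℂ H where
  carrier := {y | Tendsto (fun i => T i y) l (𝓝 y)}
  add_mem' {y z} hy hz := by
    have := Tendsto.add hy hz
    simpa using this
  zero_mem' := by simpa using tendsto_const_nhds
  smul_mem' c y hy := by
    have := Tendsto.const_smul hy c
    simpa using this

theorem mem_asymptoticFixedSubmodule {l : Filter ι} {T : ι → H →L[ℂ] H} {y : H} :
    y ∈ asymptoticFixedSubmodule l T ↔ Tendsto (fun i => T i y) l (𝓝 y) := Iff.rfl

theorem isClosed_asymptoticFixedSubmodule {l : Filter ι} {T : ι → H →L[ℂ] H}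
    (hT : ∀ᶠ i in l, ‖T i‖ ≤ 1) : IsClosed (asymptoticFixedSubmodule l T : Set H) := by
  refine isClosed_of_closure_subset fun y hy => ?_
  refine Metric.tendsto_nhds.mpr fun ε hε => ?_
  obtain ⟨z, hz, hyz⟩ := Metric.mem_closure_iff.mp hy (ε / 3) (by positivity)
  filter_upwards [hT, Metric.tendsto_nhds.mp (mem_asymptoticFixedSubmodule.mp hz) (ε / 3)
    (by positivity)] with i h1 h2
  have h3 : dist (T i y) (T i z) ≤ dist y z := by
    rw [dist_eq_norm, dist_eq_norm, ← map_sub]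
    simpa using (T i).le_of_opNorm_le h1 (y - z)
  have h4 := dist_triangle4 (T i y) (T i z) z y
  rw [dist_comm z y] at h4
  linarith

theorem matrixOperator_mul_apply {n : ℕ} (T : Matrix (Fin n) (Fin n) (H →L[ℂ] H)) (S : H →L[ℂ] H)
    (x : PiLp 2 (fun _ : Fin n => H)) :
    matrixOperator (T.map (· * S)) x = matrixOperator T (WithLp.toLp 2 fun i => S (x i)) := by
  ext i
  simp [matrixOperator_apply]

theorem norm_toLp_apply_le {n : ℕ} (S : H →L[ℂ] H) (x : PiLp 2 (fun _ : Fin n => H)) :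
    ‖(WithLp.toLp 2 fun i => S (x i) : PiLp 2 (fun _ : Fin n => H))‖ ≤ ‖S‖ * ‖x‖ := by
  refine le_of_sq_le_sq ?_ (by positivity)
  rw [mul_pow, PiLp.norm_sq_eq_of_L2, PiLp.norm_sq_eq_of_L2, Finset.mul_sum]
  refine Finset.sum_le_sum fun i _ => ?_
  rw [← mul_pow]
  exact pow_le_pow_left₀ (norm_nonneg _) (S.le_opNorm _) 2

end Hilbert

/-! ### Matrix norms on an extension, and its description as a pullback. -/

section MatrixNorms

variable {A B C : Type*} [OperatorAlgebra A] [OperatorAlgebra B] [OperatorAlgebra C]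

theorem matrixNorm_nonneg {n : ℕ} (M : Matrix (Fin n) (Fin n) A) : 0 ≤ matrixNorm M := by
  obtain ⟨H, _, _, _, π, -, h⟩ := OperatorAlgebra.exists_representation (A := A)
  rw [h]
  exact norm_nonneg _

/-- In a representation, this is composition with the diagonal operator whose entries are all `π a`.
-/
theorem matrixNorm_map_mul_le {n : ℕ} (M : Matrix (Fin n) (Fin n) A) (a : A) :
    matrixNorm (M.map (· * a)) ≤ matrixNorm M * ‖a‖ := by
  obtain ⟨H, _, _, _, π, h1, h2⟩ := OperatorAlgebra.exists_representation (A := A)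
  rw [h2, h2, ← h1]
  refine ContinuousLinearMap.opNorm_le_bound _ (by positivity) fun x => ?_
  have h3 : (M.map (· * a)).map π = (M.map π).map (· * π a) := by
    ext i j : 2
    simp
  rw [h3, matrixOperator_mul_apply, mul_assoc]
  exact (ContinuousLinearMap.le_opNorm _ _).trans
    (mul_le_mul_of_nonneg_left (norm_toLp_apply_le _ _) (norm_nonneg _))

/-- Rescaling the open unit ball; the inequality must be strict, since a lift of the same norm need
not exist. -/
theorem OAHom.IsCompleteQuotientMap.exists_map_eq {f : OAHom A B} (hf : f.IsCompleteQuotientMap)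
    {n : ℕ} (N : Matrix (Fin n) (Fin n) B) {c : ℝ} (hc : matrixNorm N < c) :
    ∃ M : Matrix (Fin n) (Fin n) A, M.map f = N ∧ matrixNorm M < c := by
  have hpos : 0 < c := (matrixNorm_nonneg N).trans_lt hc
  have hne : (c : ℂ) ≠ 0 := by exact_mod_cast hpos.ne'
  have hmem : (c : ℂ)⁻¹ • N ∈ {N : Matrix (Fin n) (Fin n) B | matrixNorm N < 1} := by
    rw [Set.mem_ofPred_eq, matrixNorm_smul, norm_inv, Complex.norm_real,
      Real.norm_of_nonneg hpos.le, inv_mul_lt_iff₀ hpos, mul_one]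
    exact hc
  rw [← hf n] at hmem
  obtain ⟨M, hM, hMN⟩ := hmem
  refine ⟨(c : ℂ) • M, ?_, ?_⟩
  · have h : ((c : ℂ) • M).map f = (c : ℂ) • M.map f := by
      ext i j
      exact map_smul f (c : ℂ) (M i j)
    rw [h, show M.map f = _ from hMN, smul_inv_smul₀ hne]
  · rw [matrixNorm_smul, Complex.norm_real, Real.norm_of_nonneg hpos.le]
    exact mul_lt_of_lt_one_right hpos hM

namespace OAExtension

variable (E : OAExtension A B C)

/-- The norm on an extension of `C` by `A` is controlled by the norm of the action on `A` and the
quotient norm: in a representation of `B`, the ideal `A` acts nondegenerately on a reducing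
subspace of `B`, and trivially on its complement. -/
theorem matrixNorm_le {l : Filter A} (hl : IsCai l) {n : ℕ} (M : Matrix (Fin n) (Fin n) B)
    {c : ℝ} (hc : 0 ≤ c) (hleft : ∀ᶠ e in l, matrixNorm (M.map (· * E.incl e)) ≤ c)
    (hproj : matrixNorm (M.map E.proj) ≤ c) : matrixNorm M ≤ c := by
  obtain ⟨H, _, _, _, π, hπ, hmat⟩ := OperatorAlgebra.exists_representation (A := B)
  have hne := hl.isApproximateUnit.neBot
  have hincl : ∀ a, ‖π (E.incl a)‖ = ‖a‖ := fun a => by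
    rw [hπ, E.incl_isCompleteIsometry.norm_map]
  have hcont : Continuous fun a => π (E.incl a) :=
    AddMonoidHomClass.continuous_of_bound
      ((π : B →ₙₐ[ℂ] (H →L[ℂ] H)).comp E.incl.toNonUnitalAlgHom) 1 fun a => by
      rw [one_mul]
      exact (hincl a).le
  have hT : ∀ᶠ e in l, ‖π (E.incl e)‖ ≤ 1 := by
    filter_upwards [hl.contractive] with e he
    rwa [hincl]
  set K := asymptoticFixedSubmodule l fun e => π (E.incl e) with hK
  have hclosed : IsClosed (K : Set H) := isClosed_asymptoticFixedSubmodule hT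
  have : CompleteSpace K := hclosed.completeSpace_coe
  -- From `e a → a` in norm.
  have hrange : ∀ a h, π (E.incl a) h ∈ K := by
    intro a h
    have h1 := (hcont.tendsto a).comp (hl.isApproximateUnit.tendsto_mul_right a)
    have h2 := ((ContinuousLinearMap.apply ℂ H h).continuous.tendsto _).comp h1
    refine h2.congr fun e => ?_
    simp
  -- Taking adjoints in `a e → a` gives convergence for the adjoint net; contractivity transfers it
  -- to the net itself. This is what makes `K` reducing although the algebra is not selfadjoint.
  have hadjoint : ∀ a h, ContinuousLinearMap.adjoint (π (E.incl a)) h ∈ K := by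
    intro a h
    refine tendsto_of_tendsto_adjoint hT ?_
    have h1 := (hcont.tendsto a).comp (hl.isApproximateUnit.tendsto_mul_left a)
    have h2 := ((ContinuousLinearMap.adjoint (𝕜 := ℂ) (E := H) (F := H)).continuous.tendsto _).comp
      h1
    have h3 := ((ContinuousLinearMap.apply ℂ H h).continuous.tendsto _).comp h2
    refine h3.congr fun e => ?_
    simp [ContinuousLinearMap.mul_def, ContinuousLinearMap.adjoint_comp]
  have hkill : ∀ a, ∀ x ∈ Kᗮ, π (E.incl a) x = 0 := by
    intro a x hx
    refine ext_inner_left ℂ fun h => ?_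
    rw [inner_zero_right, ← ContinuousLinearMap.adjoint_inner_left]
    exact (Submodule.mem_orthogonal _ _).mp hx _ (hadjoint a h)
  -- `π b y` is the limit of `π (b e) y`, and `b e` lies in the ideal `A`.
  have hBK : ∀ b, ∀ y ∈ K, π b y ∈ K := by
    intro b y hy
    refine hclosed.mem_of_tendsto (((π b).continuous.tendsto y).comp hy)
      (Eventually.of_forall fun e => ?_)
    obtain ⟨a, ha⟩ := E.exists_left b e
    have h := hrange a y
    rwa [ha, map_mul] at h
  -- For `y ∈ K`, `⟪y, π b x⟫` is the limit of `⟪y, π (e b) x⟫`, which vanishes because `e b ∈ A`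
  -- kills `x`.
  have hBK' : ∀ b, ∀ x ∈ Kᗮ, π b x ∈ Kᗮ := by
    intro b x hx
    rw [Submodule.mem_orthogonal]
    intro y hy
    have h1 : Tendsto (fun e => ContinuousLinearMap.adjoint (π (E.incl e)) y) l (𝓝 y) := by
      refine tendsto_of_tendsto_adjoint ?_ ?_
      · simpa using hT
      · simpa using mem_asymptoticFixedSubmodule.mp hy
    refine tendsto_nhds_unique (h1.inner tendsto_const_nhds)
      (tendsto_const_nhds.congr fun e => ?_)
    rw [ContinuousLinearMap.adjoint_inner_left]
    obtain ⟨a, ha⟩ := E.exists_right b e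
    have h := hkill a x hx
    rw [ha, map_mul, mul_apply_eq_comp] at h
    rw [h, inner_zero_right]
  rw [hmat]
  set T := matrixOperator (M.map π) with hTdef
  refine ContinuousLinearMap.opNorm_le_bound _ hc fun x => ?_
  let y : PiLp 2 (fun _ : Fin n => H) := WithLp.toLp 2 fun i => K.starProjection (x i)
  let z : PiLp 2 (fun _ : Fin n => H) := x - y
  have hxyz : x = y + z := (add_sub_cancel _ _).symm
  have hy : ∀ i, y i ∈ K := fun i => Submodule.starProjection_apply_mem _ _
  have hz : ∀ i, z i ∈ Kᗮ := fun i => Submodule.sub_starProjection_mem_orthogonal _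
  have orth : ∀ u v : PiLp 2 (fun _ : Fin n => H), (∀ i, u i ∈ K) → (∀ i, v i ∈ Kᗮ) →
      ‖u + v‖ ^ 2 = ‖u‖ ^ 2 + ‖v‖ ^ 2 := by
    intro u v hu hv
    simp only [sq]
    refine norm_add_sq_eq_norm_sq_add_norm_sq_of_inner_eq_zero (𝕜 := ℂ) u v ?_
    rw [PiLp.inner_apply]
    exact Finset.sum_eq_zero fun i _ => (Submodule.mem_orthogonal _ _).mp (hv i) _ (hu i)
  -- `y` is the coordinatewise limit of `π(e) y`, and `T` applied to the latter is the operator of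
  -- `M` multiplied by `e`.
  have hTy : ‖T y‖ ≤ c * ‖y‖ := by
    have h1 : Tendsto (fun e => (WithLp.toLp 2 fun i => π (E.incl e) (y i) :
        PiLp 2 (fun _ : Fin n => H))) l (𝓝 y) :=
      ((PiLp.continuous_toLp 2 (fun _ : Fin n => H)).tendsto (fun i => y i)).comp
        (tendsto_pi_nhds.mpr fun i => hy i)
    refine le_of_tendsto ((T.continuous.tendsto y).comp h1).norm ?_
    filter_upwards [hleft] with e he
    rw [hmat] at he
    have h3 : (M.map (· * E.incl e)).map π = (M.map π).map (· * π (E.incl e)) := by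
      ext i j : 2
      simp
    rw [h3] at he
    have h4 := ContinuousLinearMap.le_of_opNorm_le _ he y
    rwa [matrixOperator_mul_apply] at h4
  -- On `Kᗮ` the operator depends only on the image of `M` over `C`, so `M` may be replaced by a
  -- lift of that image of norm below `d`, for `d > c` arbitrarily close to `c`.
  have hTz : ‖T z‖ ≤ c * ‖z‖ := by
    refine le_of_forall_gt_imp_ge_of_dense fun r hr => ?_
    obtain ⟨d, hcd, hdr⟩ : ∃ d, c < d ∧ d * ‖z‖ ≤ r := by
      have h1 : Tendsto (fun d : ℝ => d * ‖z‖) (𝓝[>] c) (𝓝 (c * ‖z‖)) :=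
        ((continuous_id.mul continuous_const).tendsto c).mono_left nhdsWithin_le_nhds
      obtain ⟨d, h2, h3⟩ := ((h1.eventually (Iic_mem_nhds hr)).and self_mem_nhdsWithin).exists
      exact ⟨d, h3, h2⟩
    obtain ⟨N, hN, hNd⟩ :=
      E.proj_isCompleteQuotientMap.exists_map_eq (M.map E.proj) (hproj.trans_lt hcd)
    have h1 : T z = matrixOperator (N.map π) z := by
      ext i
      rw [hTdef, matrixOperator_apply, matrixOperator_apply]
      refine Finset.sum_congr rfl fun j _ => ?_
      have h2 : E.proj (N i j) = E.proj (M i j) := congrFun (congrFun hN i) j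
      obtain ⟨a, ha⟩ := (E.exact (M i j - N i j)).mp (by rw [map_sub, h2, sub_self])
      have h3 := hkill a _ (hz j)
      rw [ha, map_sub, sub_apply, sub_eq_zero] at h3
      simpa using h3
    rw [h1]
    rw [hmat] at hNd
    exact (ContinuousLinearMap.le_of_opNorm_le _ hNd.le z).trans hdr
  -- Pythagoras for `x` and for `T x`: the two bounds combine with the same constant because `K` is
  -- reducing.
  refine le_of_sq_le_sq ?_ (by positivity)
  rw [mul_pow]
  nth_rw 1 [hxyz]
  rw [hxyz, map_add, orth y z hy hz, orth (T y) (T z)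
    (fun i => by
      rw [hTdef, matrixOperator_apply]
      exact Submodule.sum_mem _ fun j _ => hBK _ _ (hy j))
    (fun i => by
      rw [hTdef, matrixOperator_apply]
      exact Submodule.sum_mem _ fun j _ => hBK' _ _ (hz j)), mul_add, ← mul_pow, ← mul_pow]
  gcongr

variable [ApproximatelyUnital A]

/-- An extension embeds into the pullback of `𝓜(A) → 𝓜(A) / A ← C`. -/
theorem eq_of_sigma_eq_of_proj_eq {b b' : B} (h1 : E.sigma b = E.sigma b')
    (h2 : E.proj b = E.proj b') : b = b' := by
  obtain ⟨a, ha⟩ := (E.exact (b - b')).mp (by rw [map_sub, h2, sub_self])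
  have h3 : DoubleCentralizer.coe ℂ a = (0 : 𝓜(ℂ, A)) := by
    rw [← E.sigma_incl a, ha, map_sub, h1, sub_self]
  have h4 : a = 0 := eq_of_mul_right_eq fun c => by
    have h5 := congrArg (fun x : 𝓜(ℂ, A) => x.fst c) h3
    simpa using h5
  rw [h4, map_zero] at ha
  exact sub_eq_zero.mp ha.symm

/-- An extension maps onto the pullback of `𝓜(A) → 𝓜(A) / A ← C`. -/
theorem exists_sigma_eq_and_proj_eq {x : 𝓜(ℂ, A)} {c : C} (h : coronaMk A x = E.busby c) :
    ∃ b, E.sigma b = x ∧ E.proj b = c := by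
  obtain ⟨b, rfl⟩ := E.proj_isCompleteQuotientMap.surjective c
  rw [busby_proj, coronaMk_eq_iff] at h
  obtain ⟨a, ha⟩ := h
  -- Any lift of `c` has the right multiplier up to an element of `A`, which is added without
  -- changing the image in `C`.
  refine ⟨b + E.incl a, ?_, ?_⟩
  · rw [map_add, E.sigma_incl, ha, add_sub_cancel]
  · rw [map_add, proj_incl, add_zero]

end OAExtension

end MatrixNorms

/-! ### Morphisms of extensions. -/

section ExtensionMorphisms

variable {A₁ B₁ C₁ A₂ B₂ C₂ : Type*}
  [OperatorAlgebra A₁] [OperatorAlgebra B₁] [OperatorAlgebra C₁]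
  [OperatorAlgebra A₂] [OperatorAlgebra B₂] [OperatorAlgebra C₂]
  [ApproximatelyUnital A₁] [ApproximatelyUnital A₂]
  {E₁ : OAExtension A₁ B₁ C₁} {E₂ : OAExtension A₂ B₂ C₂} {μ : OAHom A₁ A₂} {ν : OAHom C₁ C₂}

/-- Both sides have the same products with `μ a`, because `ρ` is multiplicative and restricts to
`μ`; properness makes these products decisive. -/
theorem IsExtensionMorphism.sigma_eq {ρ : OAHom B₁ B₂} (h : IsExtensionMorphism E₁ E₂ μ ρ ν)
    (hμ : μ.IsProper) (b : B₁) : E₂.sigma (ρ b) = multiplierMap μ hμ (E₁.sigma b) := by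
  refine hμ.multiplier_ext (fun a => ?_) (fun a => ?_)
  · rw [multiplierMap_fst]
    refine E₂.incl_isCompleteIsometry.injective ?_
    show E₂.incl (E₂.leftMul (ρ b) (μ a)) = E₂.incl (μ (E₁.leftMul b a))
    rw [E₂.incl_leftMul, ← h.1, ← h.1, E₁.incl_leftMul, map_mul]
  · rw [multiplierMap_snd]
    refine E₂.incl_isCompleteIsometry.injective ?_
    show E₂.incl (E₂.rightMul (ρ b) (μ a)) = E₂.incl (μ (E₁.rightMul b a))
    rw [E₂.incl_rightMul, ← h.1, ← h.1, E₁.incl_rightMul, map_mul]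

theorem IsExtensionMorphism.coronaMap_busby {ρ : OAHom B₁ B₂}
    (h : IsExtensionMorphism E₁ E₂ μ ρ ν) (hμ : μ.IsProper) (c : C₁) :
    coronaMap μ hμ (E₁.busby c) = E₂.busby (ν c) := by
  obtain ⟨b, rfl⟩ := E₁.proj_isCompleteQuotientMap.surjective c
  rw [E₁.busby_proj, coronaMap_mk, ← h.2, E₂.busby_proj, h.sigma_eq hμ]

theorem IsExtensionMorphism.unique {ρ ρ' : OAHom B₁ B₂} (h : IsExtensionMorphism E₁ E₂ μ ρ ν)
    (h' : IsExtensionMorphism E₁ E₂ μ ρ' ν) (hμ : μ.IsProper) : ρ = ρ' :=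
  DFunLike.ext _ _ fun b => E₂.eq_of_sigma_eq_of_proj_eq
    (by rw [h.sigma_eq hμ, h'.sigma_eq hμ]) (by rw [h.2, h'.2])

theorem exists_isExtensionMorphism (hμ : μ.IsProper)
    (h : ∀ c, coronaMap μ hμ (E₁.busby c) = E₂.busby (ν c)) :
    ∃ ρ : OAHom B₁ B₂, IsExtensionMorphism E₁ E₂ μ ρ ν := by
  have hex : ∀ b, ∃ b', E₂.sigma b' = multiplierMap μ hμ (E₁.sigma b) ∧
      E₂.proj b' = ν (E₁.proj b) := fun b =>
    E₂.exists_sigma_eq_and_proj_eq (by rw [← h, E₁.busby_proj, coronaMap_mk])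
  choose ρ hσ hβ using hex
  -- Each law holds because it holds in both coordinates of the pullback, which jointly separate
  -- points.
  let φ : B₁ →ₙₐ[ℂ] B₂ :=
    { toFun := ρ
      map_zero' := E₂.eq_of_sigma_eq_of_proj_eq (by simp only [hσ, map_zero])
        (by simp only [hβ, map_zero])
      map_add' := fun a b => E₂.eq_of_sigma_eq_of_proj_eq (by simp only [hσ, map_add])
        (by simp only [hβ, map_add])
      map_mul' := fun a b => E₂.eq_of_sigma_eq_of_proj_eq (by simp only [hσ, map_mul])
        (by simp only [hβ, map_mul])
      map_smul' := fun k b => E₂.eq_of_sigma_eq_of_proj_eq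
        (by simp only [hσ, map_smul, MonoidHom.id_apply])
        (by simp only [hβ, map_smul, MonoidHom.id_apply]) }
  have hmul : ∀ b a, ρ b * E₂.incl (μ a) = E₂.incl (μ (E₁.leftMul b a)) := by
    intro b a
    have h1 := congrArg (fun x : 𝓜(ℂ, A₂) => x.fst (μ a)) (hσ b)
    simp only [multiplierMap_fst] at h1
    rw [← E₂.incl_leftMul]
    exact congrArg E₂.incl h1
  refine ⟨⟨φ, fun n M => ?_⟩, fun a => ?_, hβ⟩
  · obtain ⟨l, hl, hl'⟩ := id hμ
    -- The cai of `A₂` used is the image under `μ` of one of `A₁`, so its products with `ρ(b)` come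
    -- from `A₁` through `μ`.
    refine E₂.matrixNorm_le hl' _ (matrixNorm_nonneg M) ?_ ?_
    · rw [eventually_map]
      filter_upwards [hl.contractive] with e he
      have h1 : (M.map φ.toFun).map (· * E₂.incl (μ e)) =
          ((M.map fun b => E₁.leftMul b e).map μ).map E₂.incl := by
        ext i j
        exact hmul _ _
      have h2 : (M.map fun b => E₁.leftMul b e).map E₁.incl = M.map (· * E₁.incl e) := by
        ext i j
        exact E₁.incl_leftMul _ _
      calc matrixNorm ((M.map φ.toFun).map (· * E₂.incl (μ e)))
          = matrixNorm ((M.map fun b => E₁.leftMul b e).map μ) := by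
            rw [h1, E₂.incl_isCompleteIsometry]
        _ ≤ matrixNorm (M.map fun b => E₁.leftMul b e) := μ.completely_contractive _ _
        _ = matrixNorm (M.map (· * E₁.incl e)) := by
            rw [← h2, E₁.incl_isCompleteIsometry]
        _ ≤ matrixNorm M * ‖E₁.incl e‖ := matrixNorm_map_mul_le _ _
        _ ≤ matrixNorm M := by
            rw [E₁.incl_isCompleteIsometry.norm_map]
            exact mul_le_of_le_one_right (matrixNorm_nonneg M) he
    · have h1 : (M.map φ.toFun).map E₂.proj = (M.map E₁.proj).map ν := by
        ext i j
        exact hβ _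
      rw [h1]
      exact (ν.completely_contractive _ _).trans (E₁.proj.completely_contractive _ _)
  · show ρ (E₁.incl a) = E₂.incl (μ a)
    refine E₂.eq_of_sigma_eq_of_proj_eq ?_ ?_
    · rw [hσ, E₁.sigma_incl, multiplierMap_coe, E₂.sigma_incl]
    · rw [hβ, E₁.proj_incl, E₂.proj_incl, map_zero]

end ExtensionMorphisms

theorem theorem3p4 {A₁ B₁ C₁ A₂ B₂ C₂ : Type*}
    [OperatorAlgebra A₁] [OperatorAlgebra B₁] [OperatorAlgebra C₁]
    [OperatorAlgebra A₂] [OperatorAlgebra B₂] [OperatorAlgebra C₂]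
    [ApproximatelyUnital A₁] [ApproximatelyUnital A₂]
    (E₁ : OAExtension A₁ B₁ C₁) (E₂ : OAExtension A₂ B₂ C₂)
    (μ : OAHom A₁ A₂) (hμ : μ.IsProper) (ν : OAHom C₁ C₂) :
    ((∃ ρ : OAHom B₁ B₂, IsExtensionMorphism E₁ E₂ μ ρ ν) ↔
      ∀ c : C₁, coronaMap μ hμ (E₁.busby c) = E₂.busby (ν c)) ∧
    ∀ ρ ρ' : OAHom B₁ B₂, IsExtensionMorphism E₁ E₂ μ ρ ν →
      IsExtensionMorphism E₁ E₂ μ ρ' ν → ρ = ρ' :=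
  ⟨⟨fun ⟨_, h⟩ c => h.coronaMap_busby hμ c, exists_isExtensionMorphism hμ⟩,
    fun _ _ h h' => h.unique h' hμ⟩
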